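/- Let $q,n,a,b$ be nonnegative integers with $a\le n$ and $q\ge 3$. Let $A_{q,n,a,b}$ be the $0$-$1$ matrix whose rows are indexed by the words $x$ of length $n$ over an alphabet of $q$ symbols, whose columns are indexed by the words $y$ of length $n$ over that alphabet with an added erasure mark in which exactly $a$ positions are erased, and whose entry at $(x,y)$ is $1$ if and only if $y$ differs from $x$ in at most $b$ of its non-erased positions. For a $0$-$1$ matrix $A$ with columns indexed by $Y$, let $\kappa^*(A)$ be the minimum of $\sum_{y\in Y} z_y$ over all $z\in\mathbb{R}^Y$ with $z\ge 0$ and $Az\ge\mathbf 1$ (the fractional output covering number). **Theorem.** Let $q\ge 3$ be an integer. (1) Let $n,s$ be integers with $0\le s\le n-1$ and $s$ even. Put $$b^*=\begin{cases} s/2 & \text{if } s\le \frac2q(n-1),\\[2pt] \left\lfloor\frac{n-1-s}{q-2}\right\rfloor & \text{if } s\ge\frac2q(n-1)\end{cases}$$ (the two values agree when $s=\frac2q(n-1)$). Then $b^*$ minimizes $\kappa^*(A_{q,n,s-2b,b})$ over the integers $0\le b\le s/2$. It is the unique minimizer, except that when $b^*\ge 1$ and $s+(q-2)b^*=n-1$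 the minimizers are exactly $b^*$ and $b^*-1$. (2) Let $\frac2q\le\delta\le 1$ be a real number, and let $(n_k)$, $(s_k)$ be sequences of nonnegative integers with $n_k\to\infty$, $s_k$ even, $s_k\le n_k$ and $s_k/n_k\to\delta$ (for instance $s_k=\delta n_k$, when these are even integers). Then $$\lim_{k\to\infty}\frac1{n_k}\log\min_{0\le b\le s_k/2}\kappa^*(A_{q,n_k,s_k-2b,b})=(1-\delta)\log(q-1).$$ -/

import Mathlib

open Filter Topology

noncomputable section

/-- A combinatorial channel with input set `X` and output set `Y`: a 0-1 matrix in which every row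
and every column contains a one. -/
structure IsCombChannel {X Y : Type*} (A : Matrix X Y ℝ) : Prop where
  zero_or_one : ∀ x y, A x y = 0 ∨ A x y = 1
  row : ∀ x, ∃ y, A x y = 1
  col : ∀ y, ∃ x, A x y = 1

/-- The fractional output coverings of `A`: vectors `z ≥ 0` indexed by the outputs with `A z ≥ 1`. -/
def fracCoverings {X Y : Type*} [Fintype Y] (A : Matrix X Y ℝ) : Set (Y → ℝ) :=
  {z | (∀ y, 0 ≤ z y) ∧ ∀ x, 1 ≤ A.mulVec z x}

/-- The size `κ*(A)` of the minimum fractional output covering. For a channel the infimum is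
attained, see `IsCombChannel.isLeast_kappaStar`. -/
def kappaStar {X Y : Type*} [Fintype Y] (A : Matrix X Y ℝ) : ℝ :=
  sInf ((fun z : Y → ℝ => ∑ y, z y) '' fracCoverings A)

theorem IsCombChannel.isLeast_kappaStar {X Y : Type*} [Fintype Y] {A : Matrix X Y ℝ}
    (hA : IsCombChannel A) :
    IsLeast ((fun z : Y → ℝ => ∑ y, z y) '' fracCoverings A) (kappaStar A) := by
  have hcl : IsClosed (fracCoverings A) := by
    have h1 : IsClosed {z : Y → ℝ | ∀ y, 0 ≤ z y} := by
      simp only [Set.setOf_forall]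
      exact isClosed_iInter fun y => isClosed_le continuous_const (continuous_apply y)
    have h2 : IsClosed {z : Y → ℝ | ∀ x, 1 ≤ A.mulVec z x} := by
      simp only [Set.setOf_forall]
      refine isClosed_iInter fun x => isClosed_le continuous_const ?_
      unfold Matrix.mulVec dotProduct
      fun_prop
    exact h1.inter h2
  have hone : (fun _ => 1 : Y → ℝ) ∈ fracCoverings A := by
    refine ⟨fun _ => zero_le_one, fun x => ?_⟩
    obtain ⟨y, hy⟩ := hA.row x
    have hnn : ∀ y, 0 ≤ A x y := fun y => by rcases hA.zero_or_one x y with h | h <;> simp [h]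
    calc (1 : ℝ) = A x y := hy.symm
      _ ≤ ∑ y, A x y := Finset.single_le_sum (fun y _ => hnn y) (Finset.mem_univ y)
      _ = A.mulVec (fun _ => 1) x := by simp [Matrix.mulVec, dotProduct]
  have hcpt : IsCompact (fracCoverings A ∩ Set.Icc 0 (fun _ => (Fintype.card Y : ℝ))) :=
    isCompact_Icc.inter_left hcl
  have hmem : ∀ z ∈ fracCoverings A, ∑ y, z y ≤ Fintype.card Y →
      z ∈ fracCoverings A ∩ Set.Icc 0 (fun _ => (Fintype.card Y : ℝ)) := fun z hz hs =>
    ⟨hz, fun y => hz.1 y, fun y =>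
      (Finset.single_le_sum (fun y _ => hz.1 y) (Finset.mem_univ y)).trans hs⟩
  obtain ⟨z, hz, hmin⟩ := hcpt.exists_isMinOn ⟨_, hmem _ hone (by simp)⟩
    (f := fun z : Y → ℝ => ∑ y, z y) (by fun_prop)
  have key : IsLeast ((fun z : Y → ℝ => ∑ y, z y) '' fracCoverings A) (∑ y, z y) := by
    refine ⟨⟨z, hz.1, rfl⟩, ?_⟩
    rintro _ ⟨w, hw, rfl⟩
    by_cases h : ∑ y, w y ≤ Fintype.card Y
    · exact hmin (hmem w hw h)
    · have h1 := hmin (hmem _ hone (by simp))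
      simp at h1
      exact h1.trans (not_le.mp h).le
  have h2 : kappaStar A = ∑ y, z y := key.csInf_eq
  rw [h2]
  exact key

/-- Words of length `n` over an alphabet of `q` symbols with exactly `a` erased positions
(`none` is the erasure mark). -/
abbrev ErasedWord (q n a : ℕ) : Type :=
  {y : Fin n → Option (Fin q) // (Finset.univ.filter fun i => y i = none).card = a}

/-- The number of positions at which the output `y` shows a symbol different from the one in `x`. -/
def numSubst {q n a : ℕ} (x : Fin n → Fin q) (y : ErasedWord q n a) : ℕ :=
  (Finset.univ.filter fun i => y.1 i ≠ none ∧ y.1 i ≠ some (x i)).card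

/-- The `q`-ary `n`-symbol `a`-erasure `b`-substitution channel: exactly `a` symbols are erased and
up to `b` of the others are substituted. -/
def erasureSubstChannel (q n a b : ℕ) : Matrix (Fin n → Fin q) (ErasedWord q n a) ℝ :=
  fun x y => if numSubst x y ≤ b then 1 else 0

theorem isCombChannel_erasureSubstChannel {q n a : ℕ} (b : ℕ) (hq : 0 < q) (ha : a ≤ n) :
    IsCombChannel (erasureSubstChannel q n a b) := by
  refine ⟨fun x y => ?_, fun x => ?_, fun y => ?_⟩
  · unfold erasureSubstChannel
    split_ifs <;> simp
  · obtain ⟨S, -, hS⟩ := Finset.exists_subset_card_eq (s := (Finset.univ : Finset (Fin n)))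
      (n := a) (by simpa using ha)
    refine ⟨⟨fun i => if i ∈ S then none else some (x i), by simpa using hS⟩, ?_⟩
    simp [erasureSubstChannel, numSubst]
  · refine ⟨fun i => (y.1 i).getD ⟨0, hq⟩, ?_⟩
    have h : numSubst (fun i => (y.1 i).getD ⟨0, hq⟩) y = 0 := by
      unfold numSubst
      rw [Finset.card_eq_zero, Finset.filter_eq_empty_iff]
      rintro i - ⟨h1, h2⟩
      obtain ⟨c, hc⟩ := Option.ne_none_iff_exists'.mp h1
      simp [hc] at h2
    simp [erasureSubstChannel, h]

/-- The bound given by the channel with `b` substitutions and `s - 2 * b` erasures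
(used for `2 * b ≤ s`). -/
def familyBound (q n s b : ℕ) : ℝ := kappaStar (erasureSubstChannel q n (s - 2 * b) b)

/-- The set of all minimizers of `b ↦ κ*(A_{q,n,s-2b,b})` over `0 ≤ b ≤ s/2`. -/
def familyArgmin (q n s : ℕ) : Set ℕ :=
  {b | b ≤ s / 2 ∧ ∀ c ≤ s / 2, familyBound q n s b ≤ familyBound q n s c}

/-- The minimum of `κ*(A_{q,n,s-2b,b})` over `0 ≤ b ≤ s/2`. -/
def optimizedBound (q n s : ℕ) : ℝ :=
  (Finset.range (s / 2 + 1)).inf' Finset.nonempty_range_add_one (familyBound q n s)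

end

/-! The channel matrix has constant row and column sums, so its covering number is `q ^ m / V(m,
b)`, with `m = n - s + 2 * b` and `V` the ball size for `p = q - 1`
(`kappaStar_erasureSubstChannel`).

Raising `b` by one raises `m` by two, so the sign of the increment is that of `q ^ 2 * V(m, b) - V(m
+ 2, b + 1)`. By `ballSize_add_two` this is a difference of two sphere sizes, with the sign of `(b +
1) * (q - 2) - (n - 1 - s)`. It changes sign at most once, and a tie needs exact equality: this
gives (1).

For (2), a Chernoff bound gives `(q - 1) ^ (n - s)` as a lower bound for every `b`. It is tight up
to a polynomial factor when `m = q * b`. For `δ ≥ 2 / q` some admissible `b` comes within `o(n)`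
positions of this balance. -/

/-! ### Hamming ball recursions -/

/-- The size of a Hamming ball of radius `b` in `m` positions, with `p` nontrivial changes available
at each position. -/
noncomputable def ballSize (p : ℝ) (m b : ℕ) : ℝ := ∑ i ∈ Finset.range (b + 1), (m.choose i : ℝ) * p ^ i

theorem ballSize_succ_right (p : ℝ) (m b : ℕ) :
    ballSize p m (b + 1) = ballSize p m b + (m.choose (b + 1) : ℝ) * p ^ (b + 1) :=
  Finset.sum_range_succ _ _

theorem ballSize_succ_succ (p : ℝ) (m b : ℕ) :
    ballSize p (m + 1) (b + 1) = ballSize p m (b + 1) + p * ballSize p m b := by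
  induction b with
  | zero => simp [ballSize, Finset.sum_range_succ]; ring
  | succ b ih =>
    rw [ballSize_succ_right, ih, ballSize_succ_right p m (b + 1), ballSize_succ_right p m b,
      Nat.choose_succ_succ]
    push_cast
    ring

/-- Compare with radius `b` on the first `m` positions and the last two free. Gained: `b + 1`
changes among the first `m`, none in the last two. Lost: `b` changes there and both last positions
changed. -/
theorem ballSize_add_two (p : ℝ) (m b : ℕ) :
    ballSize p (m + 2) (b + 1) = (p + 1) ^ 2 * ballSize p m b
      + ((m.choose (b + 1) : ℝ) * p ^ (b + 1) - p ^ 2 * ((m.choose b : ℝ) * p ^ b)) := by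
  have h1 := ballSize_succ_succ p (m + 1) b
  have h2 := ballSize_succ_succ p m b
  have h3 := ballSize_succ_right p (m + 1) b
  have h4 := ballSize_succ_right p m b
  rw [Nat.choose_succ_succ] at h3
  push_cast at h3
  rw [h1]
  have h5 : ballSize p (m + 1) b = ballSize p (m + 1) (b + 1)
      - ((m.choose b : ℝ) + (m.choose (b + 1) : ℝ)) * p ^ (b + 1) := by linarith
  rw [h5, h2, h4]
  ring

theorem one_le_ballSize {p : ℝ} (hp : 0 ≤ p) (m b : ℕ) : 1 ≤ ballSize p m b := by
  have := Finset.single_le_sum (f := fun i => (m.choose i : ℝ) * p ^ i)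
    (s := Finset.range (b + 1)) (fun i _ => by positivity) (Finset.mem_range.2 b.succ_pos)
  simpa [ballSize] using this

theorem ballSize_pos {p : ℝ} (hp : 0 ≤ p) (m b : ℕ) : 0 < ballSize p m b :=
  one_pos.trans_le (one_le_ballSize hp m b)

theorem ballSize_mono_left {p : ℝ} (hp : 0 ≤ p) {m m' : ℕ} (h : m ≤ m') (b : ℕ) :
    ballSize p m b ≤ ballSize p m' b := by
  unfold ballSize
  gcongr

theorem choose_mul_pow_le_ballSize {p : ℝ} (hp : 0 ≤ p) (m b : ℕ) :
    (m.choose b : ℝ) * p ^ b ≤ ballSize p m b :=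
  Finset.single_le_sum (f := fun i => (m.choose i : ℝ) * p ^ i)
    (s := Finset.range (b + 1)) (fun i _ => by positivity) (Finset.mem_range.2 (Nat.lt_succ_self b))

/-- The sphere size difference that governs the change of the bound. -/
theorem succ_mul_sphere_sub (p : ℝ) {m b : ℕ} (h : b ≤ m) :
    ((b : ℝ) + 1) * ((m.choose (b + 1) : ℝ) * p ^ (b + 1) - p ^ 2 * ((m.choose b : ℝ) * p ^ b)) =
      p ^ (b + 1) * (m.choose b : ℝ) * ((m : ℝ) - b - p * (b + 1)) := by
  have h1 : (m.choose (b + 1) : ℝ) * ((b : ℝ) + 1) = (m.choose b : ℝ) * ((m : ℝ) - b) := by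
    have := Nat.choose_succ_right_eq m b
    rw [← Nat.cast_sub h]
    exact_mod_cast this
  linear_combination p ^ (b + 1) * h1

/-! ### Chernoff bound and its converse -/

/-- The Chernoff bound for a Hamming ball at parameter `p⁻²`. -/
theorem ballSize_mul_pow_le {p : ℝ} (hp : 1 ≤ p) (m b : ℕ) :
    ballSize p m b * p ^ m ≤ p ^ (2 * b) * (p + 1) ^ m := by
  have hp0 : 0 < p := by linarith
  have h : ballSize p m b ≤ p ^ (2 * b) * (1 / p + 1) ^ m := by
    calc ballSize p m b ≤ ∑ i ∈ Finset.range (b + 1),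
          p ^ (2 * b) * ((1 / p) ^ i * (m.choose i : ℝ)) := by
          refine Finset.sum_le_sum fun i hi => ?_
          have hi' : i ≤ b := Nat.lt_succ_iff.1 (Finset.mem_range.1 hi)
          have h2 : p ^ i ≤ p ^ (2 * b) * (1 / p) ^ i := by
            rw [one_div, inv_pow, ← div_eq_mul_inv, le_div_iff₀ (by positivity), ← pow_add]
            exact pow_le_pow_right₀ hp (by omega)
          have := mul_le_mul_of_nonneg_right h2 (Nat.cast_nonneg (α := ℝ) (m.choose i))
          linarith
      _ ≤ ∑ i ∈ Finset.range (b + m + 1), p ^ (2 * b) * ((1 / p) ^ i * (m.choose i : ℝ)) :=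
          Finset.sum_le_sum_of_subset_of_nonneg (Finset.range_mono (by omega))
            fun i _ _ => by positivity
      _ = ∑ i ∈ Finset.range (m + 1), p ^ (2 * b) * ((1 / p) ^ i * (m.choose i : ℝ)) := by
          refine (Finset.sum_subset (Finset.range_mono (by omega)) fun i _ hi => ?_).symm
          rw [Finset.mem_range] at hi
          rw [Nat.choose_eq_zero_of_lt (by omega)]
          simp
      _ = p ^ (2 * b) * (1 / p + 1) ^ m := by
          rw [add_pow, ← Finset.mul_sum]
          simp
  calc ballSize p m b * p ^ m ≤ p ^ (2 * b) * (1 / p + 1) ^ m * p ^ m := by gcongr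
    _ = p ^ (2 * b) * (p + 1) ^ m := by
      rw [mul_assoc, ← mul_pow]
      congr 2
      field_simp
      ring

/-- The mode of the binomial expansion of `(1 + p) ^ ((p + 1) * b)`. -/
theorem choose_mul_pow_le_mode (p b i : ℕ) (hi : i ≤ (p + 1) * b) :
    ((p + 1) * b).choose i * p ^ ((p + 1) * b - i) ≤
      ((p + 1) * b).choose b * p ^ ((p + 1) * b - b) := by
  set m := (p + 1) * b with hm
  have hbm : b ≤ m := Nat.le_mul_of_pos_left b p.succ_pos
  -- Consecutive terms have ratio `(m - j) / ((j + 1) * p)`, which is at least 1 for `j < b` and at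
  -- most 1 for `j ≥ b`.
  have step : ∀ j, j < m → (m.choose (j + 1) * p ^ (m - (j + 1))) * ((j + 1) * p) =
      (m.choose j * p ^ (m - j)) * (m - j) := by
    intro j hj
    have h1 := Nat.choose_succ_right_eq m j
    rw [show m - j = (m - (j + 1)) + 1 by omega, pow_succ]
    rw [show m - j = (m - (j + 1)) + 1 by omega] at h1
    linear_combination p ^ (m - (j + 1)) * p * h1
  rcases le_total i b with hib | hib
  · induction hib using Nat.decreasingInduction with
    | self => exact le_rfl
    | of_succ j hj ih =>
      refine le_trans ?_ (ih (by omega))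
      have hmj : j < m := by omega
      have h2 : (j + 1) * p ≤ m - j := by
        have : (p + 1) * (j + 1) ≤ (p + 1) * b := Nat.mul_le_mul_left _ hj
        have h3 : (p + 1) * (j + 1) = (j + 1) * p + (j + 1) := by ring
        omega
      have h3 := step j hmj
      have h4 : 0 < m - j := by omega
      refine Nat.le_of_mul_le_mul_right ?_ h4
      rw [← h3]
      exact Nat.mul_le_mul_left _ h2
  · induction i, hib using Nat.le_induction with
    | base => exact le_rfl
    | succ j hj ih =>
      refine le_trans ?_ (ih (by omega))
      have hp : 0 < p := by
        rcases Nat.eq_zero_or_pos p with rfl | h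
        · simp at hm; omega
        · exact h
      have h2 : m - j ≤ (j + 1) * p := by
        have : (p + 1) * b ≤ (p + 1) * j := Nat.mul_le_mul_left _ hj
        have h3 : (p + 1) * j = j * p + j := by ring
        have h4 : (j + 1) * p = j * p + p := by ring
        omega
      refine Nat.le_of_mul_le_mul_right ?_ (Nat.mul_pos j.succ_pos hp)
      rw [step j (by omega)]
      exact Nat.mul_le_mul_left _ h2

theorem pow_le_mul_mode (p b : ℕ) :
    (p + 1) ^ ((p + 1) * b) ≤
      ((p + 1) * b + 1) * (((p + 1) * b).choose b * p ^ ((p + 1) * b - b)) := by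
  calc (p + 1) ^ ((p + 1) * b) = (1 + p) ^ ((p + 1) * b) := by rw [add_comm p 1]
    _ ≤ ∑ i ∈ Finset.range ((p + 1) * b + 1),
        ((p + 1) * b).choose b * p ^ ((p + 1) * b - b) := by
      rw [add_pow]
      refine Finset.sum_le_sum fun i hi => ?_
      have := choose_mul_pow_le_mode p b i (by have := Finset.mem_range.1 hi; omega)
      simpa [mul_comm] using this
    _ = _ := by simp

/-- Converse of the Chernoff bound at `m = (p + 1) * b`: the outermost sphere of the ball is already
the modal term, up to the factor `p ^ ((p - 1) * b)`. -/
theorem pow_le_mul_ballSize (p b : ℕ) :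
    ((p : ℝ) + 1) ^ ((p + 1) * b) ≤
      (((p + 1) * b : ℕ) + 1 : ℝ) * (p : ℝ) ^ ((p - 1) * b) * ballSize p ((p + 1) * b) b := by
  rcases Nat.eq_zero_or_pos p with rfl | hp
  · have h := one_le_ballSize (le_refl (0 : ℝ)) (1 * b) b
    have hb : (0 : ℝ) ≤ b := b.cast_nonneg
    simp at h ⊢
    nlinarith
  have h := pow_le_mul_mode p b
  have h1 : (p + 1) * b - b = (p - 1) * b + b := by
    obtain ⟨r, rfl⟩ := Nat.exists_eq_succ_of_ne_zero hp.ne'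
    simp [Nat.succ_eq_add_one, add_mul]
  rw [h1, pow_add] at h
  have h2 : ((p : ℝ) + 1) ^ ((p + 1) * b) ≤ (((p + 1) * b : ℕ) + 1 : ℝ) *
      ((((p + 1) * b).choose b : ℝ) * ((p : ℝ) ^ ((p - 1) * b) * (p : ℝ) ^ b)) := by
    exact_mod_cast h
  refine h2.trans ?_
  have h3 := choose_mul_pow_le_ballSize (p := p) p.cast_nonneg ((p + 1) * b) b
  calc _ = (((p + 1) * b : ℕ) + 1 : ℝ) * (p : ℝ) ^ ((p - 1) * b) *
        ((((p + 1) * b).choose b : ℝ) * (p : ℝ) ^ b) := by ring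
    _ ≤ _ := by gcongr

/-! ### Minimizers from increment signs -/

/-- The minimizers on `{0, …, N}` of a function whose increments at `b` have the sign of
`(b + 1) * d - e`. -/
theorem argmin_of_step_signs {f : ℕ → ℝ} {N d e : ℕ} (hd : 0 < d)
    (hlt : ∀ b < N, (b + 1) * d < e → f (b + 1) < f b)
    (heq : ∀ b < N, (b + 1) * d = e → f (b + 1) = f b)
    (hgt : ∀ b < N, e < (b + 1) * d → f b < f (b + 1)) :
    {b | b ≤ N ∧ ∀ c ≤ N, f b ≤ f c} =
      {b | b = min N (e / d) ∨ (b + 1 = min N (e / d) ∧ (b + 1) * d = e)} := by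
  set B := min N (e / d) with hB
  have hBN : B ≤ N := min_le_left _ _
  have hBe : B * d ≤ e := (Nat.le_div_iff_mul_le hd).1 (min_le_right _ _)
  have up : ∀ b, B < b → b ≤ N → f B < f b := by
    intro b hb
    have key : ∀ c, B ≤ c → c + 1 ≤ N → f c < f (c + 1) := by
      intro c hc hcN
      refine hgt c hcN ?_
      by_contra h
      have := (Nat.le_div_iff_mul_le hd).2 (not_lt.1 h)
      omega
    induction b, hb using Nat.le_induction with
    | base => exact key B le_rfl
    | succ c hc ih =>
      intro h
      exact (ih (by omega)).trans (key c (by simp at hc; omega) h)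
  have down : ∀ b, b ≤ B → f B ≤ f b := by
    intro b hb
    induction hb using Nat.decreasingInduction with
    | self => exact le_rfl
    | of_succ c hc ih =>
      refine ih.trans ?_
      have h1 : (c + 1) * d ≤ e := (Nat.mul_le_mul_right d hc).trans hBe
      rcases h1.lt_or_eq with h | h
      · exact (hlt c (by omega) h).le
      · exact (heq c (by omega) h).le
  have hmin : ∀ c ≤ N, f B ≤ f c := fun c hc =>
    (le_or_gt c B).elim (down c) fun h => (up c h hc).le
  ext b
  simp only [Set.mem_ofPred_eq]
  constructor
  · rintro ⟨hbN, hb⟩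
    have hle := hb B hBN
    rcases lt_trichotomy b B with h | h | h
    · right
      have h1 : (b + 1) * d ≤ e := (Nat.mul_le_mul_right d h).trans hBe
      have h2 : (b + 1) * d = e := by
        by_contra hne
        exact absurd ((down (b + 1) h).trans_lt (hlt b (by omega) (lt_of_le_of_ne h1 hne)))
          (not_lt.2 hle)
      refine ⟨?_, h2⟩
      -- A tie can occur only on the last step before `B`.
      have : B ≤ b + 1 := Nat.le_of_mul_le_mul_right (hBe.trans h2.ge) hd
      omega
    · exact Or.inl h
    · exact absurd (up b h hbN) (not_lt.2 hle)
  · rintro (rfl | ⟨h1, h2⟩)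
    · exact ⟨hBN, hmin⟩
    · refine ⟨by omega, fun c hc => ?_⟩
      rw [← heq b (by omega) h2, h1]
      exact hmin c hc

/-! ### Covering number of the channel -/

/-- A matrix with constant row sums `R` and constant column sums `C` has fractional output covering
number `|X| / C`. -/
theorem kappaStar_eq_of_regular {X Y : Type*} [Fintype X] [Fintype Y] [Nonempty X]
    {A : Matrix X Y ℝ} {R C : ℝ} (hR : 0 < R) (hC : 0 < C)
    (hrow : ∀ x, ∑ y, A x y = R) (hcol : ∀ y, ∑ x, A x y = C) :
    kappaStar A = Fintype.card X / C := by
  have hcount : (Fintype.card X : ℝ) * R = Fintype.card Y * C := by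
    have := Finset.sum_comm (s := (Finset.univ : Finset X)) (t := (Finset.univ : Finset Y))
      (f := fun x y => A x y)
    simpa [hrow, hcol] using this
  have hl : IsLeast ((fun z : Y → ℝ => ∑ y, z y) '' fracCoverings A) (Fintype.card X / C) := by
    constructor
    · refine ⟨fun _ => 1 / R, ⟨fun _ => by positivity, fun x => ?_⟩, ?_⟩
      · simp only [Matrix.mulVec, dotProduct]
        rw [← Finset.sum_mul, hrow, mul_one_div_cancel hR.ne']
      · simp only [Finset.sum_const, Finset.card_univ, nsmul_eq_mul]
        field_simp
        linarith
    -- The uniform dual solution `1 / C`: sum all covering constraints over `x`.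
    · rintro _ ⟨z, ⟨-, hz⟩, rfl⟩
      rw [div_le_iff₀ hC]
      calc (Fintype.card X : ℝ) = ∑ _x : X, 1 := by simp
        _ ≤ ∑ x, ∑ y, A x y * z y := Finset.sum_le_sum fun x _ => hz x
        _ = ∑ y, ∑ x, A x y * z y := Finset.sum_comm
        _ = (∑ y, z y) * C := by
          rw [Finset.sum_mul]
          refine Finset.sum_congr rfl fun y _ => ?_
          rw [← Finset.sum_mul, hcol, mul_comm]
  exact hl.csInf_eq

open Polynomial in
-- The generating function factors over positions: an erased one contributes `q`, any other `1 + (q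
-- - 1) * X`.
theorem sum_X_pow_numSubst {q n a : ℕ} (ha : a ≤ n) (y : ErasedWord q n a) :
    ∑ x : Fin n → Fin q, (X : ℝ[X]) ^ numSubst x y =
      C ((q : ℝ) ^ a) * (1 + C ((q : ℝ) - 1) * X) ^ (n - a) := by
  have h1 : ∀ x : Fin n → Fin q, (X : ℝ[X]) ^ numSubst x y =
      ∏ i, if y.1 i ≠ none ∧ y.1 i ≠ some (x i) then (X : ℝ[X]) else 1 := by
    intro x
    rw [Finset.prod_ite]
    simp [numSubst]
  have h2 : ∀ i, (∑ c : Fin q, if y.1 i ≠ none ∧ y.1 i ≠ some c then (X : ℝ[X]) else 1) =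
      if y.1 i = none then C (q : ℝ) else 1 + C ((q : ℝ) - 1) * X := by
    intro i
    rcases hy : y.1 i with _ | d
    · simp
    · have hq : 1 ≤ q := by have := d.2; omega
      rw [← Finset.add_sum_erase _ _ (Finset.mem_univ d)]
      rw [Finset.sum_congr rfl (g := fun _ => (X : ℝ[X])) fun c hc => by
        have := (Finset.mem_erase.1 hc).1.symm
        simp [this]]
      simp [Nat.cast_sub hq]
  simp_rw [h1]
  rw [← Fintype.prod_sum (fun i c => if y.1 i ≠ none ∧ y.1 i ≠ some c then (X : ℝ[X]) else 1)]
  simp_rw [h2]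
  rw [Finset.prod_ite]
  have h3 := Finset.card_filter_add_card_filter_not (s := (Finset.univ : Finset (Fin n)))
    (fun i => y.1 i = none)
  have h4 : (Finset.univ.filter fun i => ¬ y.1 i = none).card = n - a := by
    rw [y.2] at h3
    simp at h3 ⊢
    omega
  simp only [Finset.prod_const, y.2, h4, C_pow]

theorem card_numSubst_eq {q n a : ℕ} (ha : a ≤ n) (y : ErasedWord q n a) (k : ℕ) :
    ((Finset.univ.filter fun x : Fin n → Fin q => numSubst x y = k).card : ℝ) =
      (q : ℝ) ^ a * (((n - a).choose k : ℝ) * ((q : ℝ) - 1) ^ k) := by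
  have h := congrArg (fun P => Polynomial.coeff P k) (sum_X_pow_numSubst ha y)
  simp only [Polynomial.finsetSum_coeff, Polynomial.coeff_X_pow, Polynomial.coeff_C_mul] at h
  rw [Finset.sum_boole] at h
  have h5 : ((1 + Polynomial.C ((q : ℝ) - 1) * Polynomial.X) ^ (n - a)).coeff k =
      ((n - a).choose k : ℝ) * ((q : ℝ) - 1) ^ k := by
    have : (1 + Polynomial.C ((q : ℝ) - 1) * Polynomial.X) ^ (n - a) =
        ((1 + Polynomial.X) ^ (n - a)).comp (Polynomial.C ((q : ℝ) - 1) * Polynomial.X) := by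
      simp
    rw [this, Polynomial.comp_C_mul_X_coeff, Polynomial.coeff_one_add_X_pow]
  rw [h5] at h
  rw [← h]
  simp only [eq_comm]

/-- Swapping the symbols `x i` and `x' i` at each position permutes the outputs and carries one row
to the other; the common value is never needed. -/
theorem sum_erasureSubstChannel_row {q n a b : ℕ} (x x' : Fin n → Fin q) :
    ∑ y, erasureSubstChannel q n a b x y = ∑ y, erasureSubstChannel q n a b x' y := by
  let e : ErasedWord q n a ≃ ErasedWord q n a :=
    (Equiv.piCongrRight fun i => (Equiv.swap (x i) (x' i)).optionCongr).subtypeEquiv fun y => by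
      simp [-Equiv.optionCongr_swap]
  refine Fintype.sum_equiv e _ _ fun y => ?_
  have : numSubst x y = numSubst x' (e y) := by
    unfold numSubst
    congr 1
    ext i
    have he : (e y).1 i = (Equiv.swap (x i) (x' i)).optionCongr (y.1 i) := rfl
    simp only [Finset.mem_filter, Finset.mem_univ, true_and, he]
    cases y.1 i with
    | none => simp [-Equiv.optionCongr_swap]
    | some c => simp [Equiv.swap_apply_eq_iff, -Equiv.optionCongr_swap]
  simp [erasureSubstChannel, this]

theorem sum_erasureSubstChannel_col {q n a : ℕ} (b : ℕ) (ha : a ≤ n) (y : ErasedWord q n a) :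
    ∑ x, erasureSubstChannel q n a b x y = (q : ℝ) ^ a * ballSize ((q : ℝ) - 1) (n - a) b := by
  unfold ballSize
  rw [Finset.mul_sum, ← Finset.sum_congr rfl fun k _ => card_numSubst_eq ha y k]
  simp only [erasureSubstChannel]
  rw [Finset.sum_boole, Finset.card_eq_sum_card_fiberwise (f := fun x => numSubst x y)
    (t := Finset.range (b + 1)) (fun x hx => by simpa [Nat.lt_succ_iff] using hx)]
  push_cast
  refine Finset.sum_congr rfl fun k hk => ?_
  rw [Finset.filter_filter]
  congr 2
  ext x
  have := Finset.mem_range.1 hk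
  simp only [Finset.mem_filter, Finset.mem_univ, true_and]
  omega

/-- The fractional output covering number of the erasure-substitution channel. -/
theorem kappaStar_erasureSubstChannel {q n a : ℕ} (b : ℕ) (hq : 0 < q) (ha : a ≤ n) :
    kappaStar (erasureSubstChannel q n a b) =
      (q : ℝ) ^ (n - a) / ballSize ((q : ℝ) - 1) (n - a) b := by
  have hq1 : (0 : ℝ) ≤ (q : ℝ) - 1 := by
    have : (1 : ℝ) ≤ q := by exact_mod_cast hq
    linarith
  have hq0 : (0 : ℝ) < q := by exact_mod_cast hq
  have hV := ballSize_pos hq1 (n - a) b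
  let x₀ : Fin n → Fin q := fun _ => ⟨0, hq⟩
  have : Nonempty (Fin n → Fin q) := ⟨x₀⟩
  have hR : 0 < ∑ y, erasureSubstChannel q n a b x₀ y := by
    obtain ⟨y, hy⟩ := (isCombChannel_erasureSubstChannel b hq ha).row x₀
    refine Finset.sum_pos' (fun y _ => ?_) ⟨y, Finset.mem_univ y, by rw [hy]; exact one_pos⟩
    unfold erasureSubstChannel
    split_ifs <;> simp
  rw [kappaStar_eq_of_regular hR (by positivity)
    (fun x => sum_erasureSubstChannel_row x x₀) (sum_erasureSubstChannel_col b ha)]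
  have hpow : (q : ℝ) ^ n = (q : ℝ) ^ a * (q : ℝ) ^ (n - a) := by
    rw [← pow_add, Nat.add_sub_cancel' ha]
  simp only [Fintype.card_pi, Fintype.card_fin, Finset.prod_const, Finset.card_univ, Nat.cast_pow]
  rw [hpow, mul_div_mul_left _ _ (by positivity)]

/-! ### Exact minimizers -/

theorem familyBound_eq {q n s b : ℕ} (hq : 0 < q) (hs : s ≤ n) (hb : 2 * b ≤ s) :
    familyBound q n s b =
      (q : ℝ) ^ (n - s + 2 * b) / ballSize ((q : ℝ) - 1) (n - s + 2 * b) b := by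
  rw [familyBound, kappaStar_erasureSubstChannel b hq (by omega),
    show n - (s - 2 * b) = n - s + 2 * b by omega]

/-- The increment of the bound at `b` has the sign of `(b + 1) * (q - 2) - (n - 1 - s)`. -/
theorem familyBound_succ_sub {q n s b : ℕ} (hq : 3 ≤ q) (hs : s < n) (hb : 2 * (b + 1) ≤ s) :
    ∃ c : ℝ, 0 < c ∧ familyBound q n s (b + 1) - familyBound q n s b =
      c * (((b : ℝ) + 1) * ((q : ℝ) - 2) - ((n : ℝ) - 1 - s)) := by
  have hq3 : (3 : ℝ) ≤ q := by exact_mod_cast hq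
  have hp : (0 : ℝ) < (q : ℝ) - 1 := by linarith
  rw [familyBound_eq (by omega) hs.le hb, familyBound_eq (by omega) hs.le (by omega)]
  set m := n - s + 2 * b with hm
  have hmR : (m : ℝ) = (n : ℝ) - s + 2 * b := by
    rw [hm]; push_cast [Nat.cast_sub hs.le]; ring
  rw [show n - s + 2 * (b + 1) = m + 2 by omega]
  have hV := ballSize_pos hp.le m b
  have hV' := ballSize_pos hp.le (m + 2) (b + 1)
  have hrec := ballSize_add_two ((q : ℝ) - 1) m b
  have hsph := succ_mul_sphere_sub ((q : ℝ) - 1) (show b ≤ m by omega)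
  have hch : (0 : ℝ) < m.choose b := by exact_mod_cast Nat.choose_pos (show b ≤ m by omega)
  refine ⟨(q : ℝ) ^ m * (((q : ℝ) - 1) ^ (b + 1) * m.choose b) /
    (((b : ℝ) + 1) * ballSize ((q : ℝ) - 1) m b * ballSize ((q : ℝ) - 1) (m + 2) (b + 1)),
    by positivity, ?_⟩
  set V := ballSize ((q : ℝ) - 1) m b
  set V' := ballSize ((q : ℝ) - 1) (m + 2) (b + 1)
  have hd : ((b : ℝ) + 1) * ((q : ℝ) ^ 2 * V - V') = ((q : ℝ) - 1) ^ (b + 1) * m.choose b *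
      (((b : ℝ) + 1) * ((q : ℝ) - 2) - ((n : ℝ) - 1 - s)) := by
    rw [hmR] at hsph
    linear_combination -((b : ℝ) + 1) * hrec - hsph
  field_simp
  linear_combination (q : ℝ) ^ m * hd

theorem familyArgmin_eq {q n s : ℕ} (hq : 3 ≤ q) (hs : s < n) :
    familyArgmin q n s = {b | b = min (s / 2) ((n - 1 - s) / (q - 2)) ∨
      (b + 1 = min (s / 2) ((n - 1 - s) / (q - 2)) ∧ (b + 1) * (q - 2) = n - 1 - s)} := by
  have hD : ∀ b : ℕ, ((b : ℝ) + 1) * ((q : ℝ) - 2) - ((n : ℝ) - 1 - s) =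
      (((b + 1) * (q - 2) : ℕ) : ℝ) - ((n - 1 - s : ℕ) : ℝ) := by
    intro b
    rw [Nat.cast_sub (show s ≤ n - 1 by omega), Nat.cast_sub (show 1 ≤ n by omega),
      Nat.cast_mul, Nat.cast_sub (show 2 ≤ q by omega)]
    push_cast
    ring
  refine argmin_of_step_signs (by omega) (fun b hb h => ?_) (fun b hb h => ?_) fun b hb h => ?_
  all_goals
    obtain ⟨c, hc, hf⟩ := familyBound_succ_sub hq hs (show 2 * (b + 1) ≤ s by omega)
    rw [hD] at hf
  · have : (((b + 1) * (q - 2) : ℕ) : ℝ) < ((n - 1 - s : ℕ) : ℝ) := by exact_mod_cast h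
    have := mul_neg_of_pos_of_neg hc (sub_neg.2 this)
    linarith
  · rw [h, sub_self, mul_zero] at hf
    linarith
  · have : ((n - 1 - s : ℕ) : ℝ) < (((b + 1) * (q - 2) : ℕ) : ℝ) := by exact_mod_cast h
    have := mul_pos hc (sub_pos.2 this)
    linarith

/-! ### Exponential growth rate -/

theorem pow_le_familyBound {q n s b : ℕ} (hq : 2 ≤ q) (hs : s ≤ n) (hb : 2 * b ≤ s) :
    ((q : ℝ) - 1) ^ (n - s) ≤ familyBound q n s b := by
  have hq2 : (2 : ℝ) ≤ q := by exact_mod_cast hq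
  have hp : (1 : ℝ) ≤ (q : ℝ) - 1 := by linarith
  have hp0 : (0 : ℝ) < (q : ℝ) - 1 := by linarith
  rw [familyBound_eq (by omega) hs hb, le_div_iff₀ (ballSize_pos hp0.le _ _)]
  have h := ballSize_mul_pow_le hp (n - s + 2 * b) b
  rw [sub_add_cancel] at h
  refine le_of_mul_le_mul_right (a := ((q : ℝ) - 1) ^ (2 * b)) ?_ (by positivity)
  calc _ = ballSize ((q : ℝ) - 1) (n - s + 2 * b) b * ((q : ℝ) - 1) ^ (n - s + 2 * b) := by
        rw [pow_add]; ring
    _ ≤ _ := h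
    _ = _ := by ring

/-- Shrink the ball to `q * b` positions, where the Chernoff bound is nearly tight; each discarded
position costs a factor `q`. -/
theorem familyBound_le {q n s b : ℕ} (hq : 2 ≤ q) (hs : s ≤ n) (hb : 2 * b ≤ s)
    (hbq : (q - 2) * b ≤ n - s) :
    familyBound q n s b ≤
      (q : ℝ) ^ (n - s - (q - 2) * b) * ((n : ℝ) + 1) * ((q : ℝ) - 1) ^ (n - s) := by
  obtain ⟨r, rfl⟩ := Nat.exists_eq_add_of_le hq
  have hr : 2 + r - 2 = r := by omega
  rw [hr] at hbq ⊢
  have hp : (1 : ℝ) ≤ ((2 + r : ℕ) : ℝ) - 1 := by push_cast; linarith [r.cast_nonneg (α := ℝ)]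
  rw [familyBound_eq (by omega) hs hb, div_le_iff₀ (ballSize_pos (by linarith) _ _)]
  have hpe : ((2 + r : ℕ) : ℝ) - 1 = ((r + 1 : ℕ) : ℝ) := by push_cast; ring
  have hmb : (r + 1 + 1) * b = r * b + 2 * b := by ring
  have h := pow_le_mul_ballSize (r + 1) b
  rw [← hpe, sub_add_cancel, Nat.add_sub_cancel] at h
  have hV : ballSize (((2 + r : ℕ) : ℝ) - 1) ((r + 1 + 1) * b) b ≤
      ballSize (((2 + r : ℕ) : ℝ) - 1) (n - s + 2 * b) b :=
    ballSize_mono_left (by linarith) (by omega) b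
  have hV0 := ballSize_pos (show (0 : ℝ) ≤ ((2 + r : ℕ) : ℝ) - 1 by linarith) ((r + 1 + 1) * b) b
  have hc : (((r + 1 + 1) * b : ℕ) : ℝ) ≤ n := by exact_mod_cast (by omega)
  calc ((2 + r : ℕ) : ℝ) ^ (n - s + 2 * b)
      = ((2 + r : ℕ) : ℝ) ^ (n - s - r * b) * ((2 + r : ℕ) : ℝ) ^ ((r + 1 + 1) * b) := by
        rw [← pow_add]; congr 1; omega
    _ ≤ ((2 + r : ℕ) : ℝ) ^ (n - s - r * b) * (((n : ℝ) + 1) *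
          (((2 + r : ℕ) : ℝ) - 1) ^ (n - s) *
          ballSize (((2 + r : ℕ) : ℝ) - 1) (n - s + 2 * b) b) := by
        refine mul_le_mul_of_nonneg_left (h.trans ?_) (by positivity)
        gcongr
    _ = _ := by ring

theorem pow_le_optimizedBound {q n s : ℕ} (hq : 2 ≤ q) (hs : s ≤ n) :
    ((q : ℝ) - 1) ^ (n - s) ≤ optimizedBound q n s :=
  Finset.le_inf' _ _ fun b hb =>
    pow_le_familyBound hq hs (by have := Finset.mem_range.1 hb; omega)

theorem optimizedBound_le {q n s : ℕ} (hq : 3 ≤ q) (hs : s ≤ n) (hse : Even s) :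
    optimizedBound q n s ≤
      (q : ℝ) ^ max (q : ℝ) ((n : ℝ) - q * s / 2) * ((n : ℝ) + 1) * ((q : ℝ) - 1) ^ (n - s) := by
  have hq3 : (3 : ℝ) ≤ q := by exact_mod_cast hq
  -- The largest admissible `b` allowed by `familyBound_le`. The leftover exponent is `n - q * s /
  -- 2` in the first case and a remainder modulo `q - 2` in the second.
  set b := min (s / 2) ((n - s) / (q - 2)) with hb
  have hbq : (q - 2) * b ≤ n - s :=
    (Nat.mul_le_mul_left _ (min_le_right _ _)).trans (Nat.mul_div_le _ _)
  have hbs : b ≤ s / 2 := min_le_left _ _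
  have hopt : optimizedBound q n s ≤ familyBound q n s b :=
    Finset.inf'_le _ (Finset.mem_range.2 (by omega))
  refine (hopt.trans (familyBound_le (by omega) hs (by omega) hbq)).trans ?_
  have hg : ((n - s - (q - 2) * b : ℕ) : ℝ) ≤ max (q : ℝ) ((n : ℝ) - q * s / 2) := by
    rcases le_total (s / 2) ((n - s) / (q - 2)) with h | h
    · refine le_max_of_le_right (le_of_eq ?_)
      obtain ⟨t, rfl⟩ := hse
      rw [hb, min_eq_left h, show (t + t) / 2 = t by omega] at *
      rw [Nat.cast_sub hbq, Nat.cast_sub hs, Nat.cast_mul, Nat.cast_sub (show 2 ≤ q by omega)]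
      push_cast
      ring
    · refine le_max_of_le_left ?_
      rw [hb, min_eq_right h]
      have h1 := Nat.div_add_mod (n - s) (q - 2)
      have h2 := Nat.mod_lt (n - s) (show 0 < q - 2 by omega)
      exact_mod_cast (by omega : n - s - (q - 2) * ((n - s) / (q - 2)) ≤ q)
  have hp : (0 : ℝ) ≤ (q : ℝ) - 1 := by linarith
  rw [← Real.rpow_natCast (q : ℝ) (n - s - (q - 2) * b)]
  gcongr
  linarith

theorem tendsto_log_optimizedBound {q : ℕ} (hq : 3 ≤ q) {δ : ℝ} (hδ : 2 / (q : ℝ) ≤ δ)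
    {n s : ℕ → ℕ} (hn : Tendsto n atTop atTop) (hse : ∀ k, Even (s k)) (hsn : ∀ k, s k ≤ n k)
    (hlim : Tendsto (fun k => (s k : ℝ) / (n k : ℝ)) atTop (𝓝 δ)) :
    Tendsto (fun k => 1 / (n k : ℝ) * Real.log (optimizedBound q (n k) (s k))) atTop
      (𝓝 ((1 - δ) * Real.log ((q : ℝ) - 1))) := by
  have hq3 : (3 : ℝ) ≤ q := by exact_mod_cast hq
  have hp : (0 : ℝ) < (q : ℝ) - 1 := by linarith
  have hnR : Tendsto (fun k => (n k : ℝ)) atTop atTop := tendsto_natCast_atTop_atTop.comp hn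
  have hmain : Tendsto (fun k => (1 - (s k : ℝ) / (n k : ℝ)) * Real.log ((q : ℝ) - 1)) atTop
      (𝓝 ((1 - δ) * Real.log ((q : ℝ) - 1))) := (hlim.const_sub 1).mul_const _
  have hgap : Tendsto (fun k => max ((q : ℝ) / n k) (1 - q / 2 * ((s k : ℝ) / n k))) atTop
      (𝓝 0) := by
    have h1 : Tendsto (fun k => (q : ℝ) / n k) atTop (𝓝 0) := hnR.const_div_atTop _
    have h2 := (hlim.const_mul ((q : ℝ) / 2)).const_sub 1
    have h3 := h1.max h2
    -- The only use of `δ ≥ 2 / q`: the leftover exponent is `o(n)`.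
    have h4 : 1 - (q : ℝ) / 2 * δ ≤ 0 := by
      rw [div_le_iff₀ (by linarith)] at hδ
      linarith
    rwa [max_eq_left h4] at h3
  have hlog : Tendsto (fun k => Real.log ((n k : ℝ) + 1) / n k) atTop (𝓝 0) := by
    have h1 : Tendsto (fun x : ℝ => Real.log (x + 1) / x) atTop (𝓝 0) := by
      have h2 : Tendsto (fun x : ℝ => Real.log (x + 1) / (x + 1)) atTop (𝓝 0) :=
        (Real.isLittleO_log_id_atTop.tendsto_div_nhds_zero).comp
          (tendsto_atTop_add_const_right _ 1 tendsto_id)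
      have h3 : Tendsto (fun x : ℝ => 1 + 1 / x) atTop (𝓝 (1 + 0)) :=
        (tendsto_id.const_div_atTop 1).const_add 1
      have h4 := h2.mul h3
      rw [zero_mul] at h4
      refine h4.congr' ?_
      filter_upwards [eventually_gt_atTop 0] with x hx
      field_simp
    exact h1.comp hnR
  have hupper := ((hgap.mul_const (Real.log q)).add hlog).add hmain
  rw [zero_mul, zero_add, zero_add] at hupper
  refine tendsto_of_tendsto_of_tendsto_of_le_of_le' hmain hupper ?_ ?_
  all_goals
    filter_upwards [hnR.eventually_gt_atTop 0] with k hk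
    have hlow := pow_le_optimizedBound (q := q) (by omega) (hsn k)
    have hpow : 0 < ((q : ℝ) - 1) ^ (n k - s k) := by positivity
    have hlogpow : Real.log (((q : ℝ) - 1) ^ (n k - s k)) =
        ((n k : ℝ) - s k) * Real.log ((q : ℝ) - 1) := by
      rw [Real.log_pow, Nat.cast_sub (hsn k)]
    have hmul : (1 - (s k : ℝ) / (n k : ℝ)) * Real.log ((q : ℝ) - 1) =
        1 / (n k : ℝ) * (((n k : ℝ) - s k) * Real.log ((q : ℝ) - 1)) := by
      field_simp
  · rw [hmul, ← hlogpow]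
    exact mul_le_mul_of_nonneg_left (Real.log_le_log hpow hlow) (by positivity)
  · have h := Real.log_le_log (hpow.trans_le hlow) (optimizedBound_le hq (hsn k) (hse k))
    rw [Real.log_mul (by positivity) (by positivity), Real.log_mul (by positivity) (by positivity),
      Real.log_rpow (by linarith), hlogpow] at h
    have hmax : max ((q : ℝ) / n k) (1 - q / 2 * ((s k : ℝ) / n k)) =
        1 / (n k : ℝ) * max (q : ℝ) ((n k : ℝ) - q * s k / 2) := by
      rw [mul_max_of_nonneg _ _ (by positivity)]
      congr 1 <;> field_simp
    calc _ ≤ 1 / (n k : ℝ) * (max (q : ℝ) ((n k : ℝ) - q * s k / 2) * Real.log q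
          + Real.log ((n k : ℝ) + 1) + ((n k : ℝ) - s k) * Real.log ((q : ℝ) - 1)) :=
          mul_le_mul_of_nonneg_left h (by positivity)
      _ = _ := by rw [hmax, hmul]; ring


theorem mainTheorem6 (q : ℕ) (hq : 3 ≤ q) :
    (∀ n s : ℕ, s < n → Even s →
      ((s : ℝ) ≤ 2 / (q : ℝ) * ((n : ℝ) - 1) →
        familyArgmin q n s =
          {b | b = s / 2 ∨ (b + 1 = s / 2 ∧ (s : ℝ) = 2 / (q : ℝ) * ((n : ℝ) - 1))}) ∧
      (2 / (q : ℝ) * ((n : ℝ) - 1) ≤ (s : ℝ) →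
        familyArgmin q n s =
          {b | b = ⌊((n : ℝ) - 1 - s) / ((q : ℝ) - 2)⌋₊ ∨
            (b + 1 = ⌊((n : ℝ) - 1 - s) / ((q : ℝ) - 2)⌋₊ ∧
              ((b : ℝ) + 1) = ((n : ℝ) - 1 - s) / ((q : ℝ) - 2))})) ∧
    (∀ δ : ℝ, 2 / (q : ℝ) ≤ δ → δ ≤ 1 →
      ∀ n s : ℕ → ℕ, Tendsto n atTop atTop → (∀ k, Even (s k)) → (∀ k, s k ≤ n k) →
        Tendsto (fun k => (s k : ℝ) / (n k : ℝ)) atTop (𝓝 δ) →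
        Tendsto (fun k => 1 / (n k : ℝ) * Real.log (optimizedBound q (n k) (s k))) atTop
          (𝓝 ((1 - δ) * Real.log ((q : ℝ) - 1)))) := by
  refine ⟨fun n s hs hse => ?_, fun δ hδ _ n s hn hse hsn hlim =>
    tendsto_log_optimizedBound hq hδ hn hse hsn hlim⟩
  have hq3 : (3 : ℝ) ≤ q := by exact_mod_cast hq
  have hd : (0 : ℝ) < (q : ℝ) - 2 := by linarith
  have hdc : ((q - 2 : ℕ) : ℝ) = (q : ℝ) - 2 := by rw [Nat.cast_sub (by omega)]; norm_num
  have hec : ((n - 1 - s : ℕ) : ℝ) = (n : ℝ) - 1 - s := by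
    rw [Nat.cast_sub (by omega), Nat.cast_sub (by omega)]; norm_num
  have hhalf : ((s / 2 : ℕ) : ℝ) = s / 2 := by
    obtain ⟨t, rfl⟩ := hse
    rw [show (t + t) / 2 = t by omega]; push_cast; ring
  have hfloor : ⌊((n : ℝ) - 1 - s) / ((q : ℝ) - 2)⌋₊ = (n - 1 - s) / (q - 2) := by
    rw [← hdc, ← hec, Nat.floor_div_eq_div]
  have heq : ∀ b : ℕ, (b + 1) * (q - 2) = n - 1 - s ↔
      ((b : ℝ) + 1) * ((q : ℝ) - 2) = (n : ℝ) - 1 - s := by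
    intro b
    rw [← hdc, ← hec]
    norm_cast
  have h2q : 2 / (q : ℝ) * ((n : ℝ) - 1) = 2 * ((n : ℝ) - 1) / q := by ring
  rw [familyArgmin_eq hq hs, hfloor, h2q]
  constructor
  · intro h
    -- The threshold `q * s ≤ 2 * (n - 1)` rearranges to `(s / 2) * (q - 2) ≤ n - 1 - s`, so it
    -- decides which term attains the minimum.
    rw [le_div_iff₀ (by linarith)] at h
    have hle : s / 2 ≤ (n - 1 - s) / (q - 2) := by
      rw [Nat.le_div_iff_mul_le (by omega)]
      have : ((s / 2 : ℕ) : ℝ) * ((q - 2 : ℕ) : ℝ) ≤ ((n - 1 - s : ℕ) : ℝ) := by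
        rw [hhalf, hdc, hec]; linarith
      exact_mod_cast this
    rw [min_eq_left hle]
    ext b
    simp only [Set.mem_ofPred_eq]
    refine or_congr_right (and_congr_right fun hb => ?_)
    have hbR : (b : ℝ) + 1 = s / 2 := by rw [← hhalf, ← hb]; push_cast; rfl
    rw [heq, hbR, eq_div_iff (by linarith)]
    constructor <;> intro h' <;> linarith
  · intro h
    rw [div_le_iff₀ (by linarith)] at h
    have hle : (n - 1 - s) / (q - 2) ≤ s / 2 := by
      refine Nat.div_le_of_le_mul ?_
      have : ((n - 1 - s : ℕ) : ℝ) ≤ ((q - 2 : ℕ) : ℝ) * ((s / 2 : ℕ) : ℝ) := by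
        rw [hhalf, hdc, hec]; linarith
      exact_mod_cast this
    rw [min_eq_right hle]
    ext b
    simp only [Set.mem_ofPred_eq]
    rw [heq, eq_div_iff hd.ne']
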